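/- Let $(B,\le)$ be a Boolean algebra with complement ${}^*$ (the case $0=1$ is allowed). A \emph{local contact algebra} $(B,\rho,\mathbb B)$ consists of a Boolean algebra $B$, a binary relation $\rho$ on $B$ and a subset $\mathbb B\subseteq B$ such that, writing $a\ll_\rho b$ for "not $a\,\rho\,b^*$": (C1) $a\neq 0\Rightarrow a\rho a$; (C2) $a\rho b\Rightarrow a\ne0$ and $b\neq 0$; (C3) $a\rho b\Rightarrow b\rho a$; (C4) $a\rho(b\vee c)$ iff $a\rho b$ or $a\rho c$; (BB1)–(BB3) $0\in\mathbb B$, $\mathbb B$ is closed downwards and under $\vee$; (BC1) if $a\in\mathbb B$ and $a\ll_\rho c$, then $a\ll_\rho b\ll_\rho c$ for some $b\in\mathbb B$; (BC2) if $a\rho b$, then $a\rho(c\wedge b)$ for some $c\in\mathbb B$; (BC3) if $a\ne 0$, then $b\ll_\rho a$ for some $b\in\mathbb B\setminus\{0\}$. An \emph{MVD-algebra} $(B,\le,\ll)$ is a Boolean algebra with a binary relation $\ll$ such that: ($\ll$1) $a\ll b\Rightarrow a\le b$; ($\ll$2) $0\ll 0$; ($\ll$3) $a\le b\ll c\le t\Rightarrow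 a\ll t$; ($\ll$4) $a\ll c$ and $b\ll c$ imply $a\vee b\ll c$; ($\ll$5) $a\ll c$ implies $a\ll b\ll c$ for some $b$; ($\ll$6) if $a\ne0$, then $b\ll a$ for some $b\neq 0$; ($\ll4^*$) $a\ll b$ and $a\ll c$ imply $a\ll b\wedge c$; (MVD) if $a\ll 1$ and $b^*\ll a^*$, then $a\ll b$. Either kind of algebra is \emph{complete} if $B$ is a complete Boolean algebra. Let $\mathbf{DHLC}$ be the category whose objects are the complete local contact algebras and whose morphisms $(A,\rho,\mathbb B)\to(B,\eta,\mathbb B')$ are the functions $\psi:A\to B$ with (DLC1) $\psi(0)=0$; (DLC2) $\psi(a\wedge b)=\psi(a)\wedge\psi(b)$; (DLC3) if $a\in\mathbb B$ and $a\ll_\rho b$, then $(\psi(a^*))^*\ll_\eta\psi(b)$; (DLC4) for every $b\in\mathbb B'$ there is $a\in\mathbb B$ with $b\le\psi(a)$; (DLC5) $\psi(a)=\bigvee\{\psi(b): b\in\mathbb B,\ b\ll_\rho a\}$ for all $a\in A$; the composition is $(\psi_2\odot\psi_1)(a)=\bigvee\{\psi_2(\psi_1(b)): b\in\mathbb B_1,\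 b\ll_{\rho_1}a\}$ for $\psi_1$ with domain $(A_1,\rho_1,\mathbb B_1)$. Let $\mathbf{MVDHLC}$ be the category whose objects are the complete MVD-algebras and whose morphisms $(A,\le,\ll)\to(B,\le',\ll')$ are the functions $\psi:A\to B$ with (MVDLC1) $\psi(0)=0$; (MVDLC2) $\psi(a\wedge b)=\psi(a)\wedge\psi(b)$; (MVDLC3) if $a\ll b$, then $(\psi(a^*))^*\wedge c\ll'\psi(b)\vee c^*$ for every $c\ll'1$; (MVDLC4) for every $b\ll'1$ there is $a\ll 1$ with $b\le'\psi(a)$; (MVDLC5) $\psi(a)=\bigvee\{\psi(b): b\ll a\}$ for all $a\in A$; the composition is $(\psi_2\circledcirc\psi_1)(a)=\bigvee\{\psi_2(\psi_1(b)): b\ll_1 a\}$ for $\psi_1$ with domain $(A_1,\le_1,\ll_1)$. In both categories the identity morphisms are the identity functions. Then the categories $\mathbf{DHLC}$ and $\mathbf{MVDHLC}$ are isomorphic, and hence $\mathbf{MVDHLC}$ is dually equivalent to the category $\mathbf{HLC}$ of all locally compact Hausdorff spaces and all continuous maps. -/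

import Mathlib

open CategoryTheory

universe u

/-! ### Contact algebras and local contact algebras -/

/-- `C` is a contact relation on the Boolean algebra `B` (axioms (C1)-(C4)). -/
structure IsContact {B : Type*} [BooleanAlgebra B] (C : B → B → Prop) : Prop where
  c1 : ∀ a, a ≠ ⊥ → C a a
  c2 : ∀ a b, C a b → a ≠ ⊥ ∧ b ≠ ⊥
  c3 : ∀ a b, C a b → C b a
  c4 : ∀ a b c, C a (b ⊔ c) ↔ C a b ∨ C a c

/-- Non-tangential inclusion: `a ≪ b` iff `a` is not in contact with the complement of `b`. -/
def NTI {B : Type*} [BooleanAlgebra B] (C : B → B → Prop) (a b : B) : Prop :=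
  ¬ C a bᶜ

/-- `(B, ρ, 𝔹)` is a local contact algebra; `bdd` is the set `𝔹` of bounded elements. -/
structure IsLCA {B : Type*} [BooleanAlgebra B] (ρ : B → B → Prop) (bdd : Set B) : Prop
    extends IsContact ρ where
  bb1 : ⊥ ∈ bdd
  bb2 : ∀ a b, a ≤ b → b ∈ bdd → a ∈ bdd
  bb3 : ∀ a b, a ∈ bdd → b ∈ bdd → a ⊔ b ∈ bdd
  bc1 : ∀ a c, a ∈ bdd → NTI ρ a c → ∃ b ∈ bdd, NTI ρ a b ∧ NTI ρ b c
  bc2 : ∀ a b, ρ a b → ∃ c ∈ bdd, ρ a (c ⊓ b)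
  bc3 : ∀ a, a ≠ ⊥ → ∃ b ∈ bdd, b ≠ ⊥ ∧ NTI ρ b a

/-! ### MVD-algebras -/

/-- `(B, ≤, ≪)` is an MVD-algebra. -/
structure IsMVD {B : Type*} [BooleanAlgebra B] (ll : B → B → Prop) : Prop where
  ll1 : ∀ a b, ll a b → a ≤ b
  ll2 : ll ⊥ ⊥
  ll3 : ∀ a b c t, a ≤ b → ll b c → c ≤ t → ll a t
  ll4 : ∀ a b c, ll a c → ll b c → ll (a ⊔ b) c
  ll5 : ∀ a c, ll a c → ∃ b, ll a b ∧ ll b c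
  ll6 : ∀ a, a ≠ ⊥ → ∃ b, b ≠ ⊥ ∧ ll b a
  ll4' : ∀ a b c, ll a b → ll a c → ll a (b ⊓ c)
  mvd : ∀ a b, ll a ⊤ → ll bᶜ aᶜ → ll a b

/-! ### Morphisms and compositions -/

/-- The axioms (DLC1)-(DLC5) on a function between complete local contact algebras. -/
structure IsDLC {A B : Type*} [CompleteBooleanAlgebra A] [CompleteBooleanAlgebra B]
    (ρ : A → A → Prop) (bddA : Set A) (η : B → B → Prop) (bddB : Set B)
    (ψ : A → B) : Prop where
  dlc1 : ψ ⊥ = ⊥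
  dlc2 : ∀ a b, ψ (a ⊓ b) = ψ a ⊓ ψ b
  dlc3 : ∀ a b, a ∈ bddA → NTI ρ a b → NTI η (ψ aᶜ)ᶜ (ψ b)
  dlc4 : ∀ b ∈ bddB, ∃ a ∈ bddA, b ≤ ψ a
  dlc5 : ∀ a, ψ a = sSup {x | ∃ b ∈ bddA, NTI ρ b a ∧ x = ψ b}

/-- The composition `ψ₂ ⊙ ψ₁`; `ρ` and `bdd` belong to the domain of `ψ₁`. -/
def dlcComp {A₁ A₂ A₃ : Type*} [CompleteBooleanAlgebra A₁] [CompleteBooleanAlgebra A₃]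
    (ρ : A₁ → A₁ → Prop) (bdd : Set A₁) (ψ₂ : A₂ → A₃) (ψ₁ : A₁ → A₂) (a : A₁) : A₃ :=
  sSup {x | ∃ b ∈ bdd, NTI ρ b a ∧ x = ψ₂ (ψ₁ b)}

/-- The axioms (MVDLC1)-(MVDLC5) on a function between complete MVD-algebras. -/
structure IsMVDLC {A B : Type*} [CompleteBooleanAlgebra A] [CompleteBooleanAlgebra B]
    (llA : A → A → Prop) (llB : B → B → Prop) (ψ : A → B) : Prop where
  mvdlc1 : ψ ⊥ = ⊥
  mvdlc2 : ∀ a b, ψ (a ⊓ b) = ψ a ⊓ ψ b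
  mvdlc3 : ∀ a b, llA a b → ∀ c, llB c ⊤ → llB ((ψ aᶜ)ᶜ ⊓ c) (ψ b ⊔ cᶜ)
  mvdlc4 : ∀ b, llB b ⊤ → ∃ a, llA a ⊤ ∧ b ≤ ψ a
  mvdlc5 : ∀ a, ψ a = sSup {x | ∃ b, llA b a ∧ x = ψ b}

/-- The composition `ψ₂ ⊚ ψ₁`; `ll` belongs to the domain of `ψ₁`. -/
def mvdComp {A₁ A₂ A₃ : Type*} [CompleteBooleanAlgebra A₁] [CompleteBooleanAlgebra A₃]
    (ll : A₁ → A₁ → Prop) (ψ₂ : A₂ → A₃) (ψ₁ : A₁ → A₂) (a : A₁) : A₃ :=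
  sSup {x | ∃ b, ll b a ∧ x = ψ₂ (ψ₁ b)}

/-! ### Helper facts: local contact algebras -/

section LCAFacts

variable {B : Type*} [BooleanAlgebra B] {ρ : B → B → Prop} {bdd : Set B}

theorem IsContact.mono_right {a b c : B} (h : IsContact ρ) (hbc : b ≤ c) (hab : ρ a b) :
    ρ a c := by
  have := (h.c4 a b c).2 (Or.inl hab)
  rwa [sup_eq_right.2 hbc] at this

theorem IsContact.mono {a b a' b' : B} (h : IsContact ρ) (ha : a ≤ a') (hb : b ≤ b')
    (hab : ρ a b) : ρ a' b' :=
  h.c3 _ _ (h.mono_right ha (h.c3 _ _ (h.mono_right hb hab)))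

theorem IsContact.nti_mono {a b a' b' : B} (h : IsContact ρ) (ha : a' ≤ a) (hb : b ≤ b')
    (hab : NTI ρ a b) : NTI ρ a' b' :=
  fun hc => hab (h.mono ha (compl_le_compl hb) hc)

theorem IsContact.nti_le {a b : B} (h : IsContact ρ) (hab : NTI ρ a b) : a ≤ b := by
  by_contra hle
  have hne : a ⊓ bᶜ ≠ ⊥ := fun h0 => hle (disjoint_compl_right_iff.1 (disjoint_iff.2 h0))
  exact hab (h.mono inf_le_left inf_le_right (h.c1 _ hne))

theorem IsContact.nti_compl {a b : B} (h : IsContact ρ) (hab : NTI ρ a b) :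
    NTI ρ bᶜ aᶜ := by
  unfold NTI at *
  rw [compl_compl]
  exact fun hc => hab (h.c3 _ _ hc)

theorem IsContact.nti_inf_right {a b c : B} (h : IsContact ρ) (hb : NTI ρ a b)
    (hc : NTI ρ a c) : NTI ρ a (b ⊓ c) := by
  unfold NTI at *
  rw [compl_inf, h.c4]
  tauto

theorem IsContact.nti_inf {a b c d : B} (h : IsContact ρ) (hb : NTI ρ a b)
    (hc : NTI ρ c d) : NTI ρ (a ⊓ c) (b ⊓ d) :=
  h.nti_inf_right (h.nti_mono inf_le_left le_rfl hb) (h.nti_mono inf_le_right le_rfl hc)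

theorem IsContact.nti_top (h : IsContact ρ) (a : B) : NTI ρ a ⊤ := by
  unfold NTI
  rw [compl_top]
  exact fun hc => (h.c2 _ _ hc).2 rfl

theorem IsLCA.nti_of_bdd {a b : B} (h : IsLCA ρ bdd)
    (hc : ∀ c ∈ bdd, NTI ρ (a ⊓ c) b) : NTI ρ a b := by
  intro hab
  obtain ⟨c, hcb, hr⟩ := h.bc2 _ _ (h.c3 _ _ hab)
  exact hc c hcb (h.c3 _ _ (by rwa [inf_comm]))

theorem IsLCA.sSup_nti {B : Type*} [CompleteBooleanAlgebra B] {ρ : B → B → Prop} {bdd : Set B}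
    (h : IsLCA ρ bdd) (a : B) :
    a = sSup {x | ∃ b ∈ bdd, NTI ρ b a ∧ x = b} := by
  apply le_antisymm
  · by_contra hle
    set s := sSup {x | ∃ b ∈ bdd, NTI ρ b a ∧ x = b} with hs
    have hne : a ⊓ sᶜ ≠ ⊥ := fun h0 => hle (disjoint_compl_right_iff.1 (disjoint_iff.2 h0))
    obtain ⟨b, hb, hb0, hba⟩ := h.bc3 _ hne
    have h1 : b ≤ s := le_sSup ⟨b, hb, h.nti_mono le_rfl inf_le_left hba, rfl⟩
    have h2 : b ≤ sᶜ := (h.nti_le hba).trans inf_le_right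
    exact hb0 (le_bot_iff.1 (by simpa using le_inf h1 h2))
  · exact sSup_le (by rintro x ⟨b, -, hba, rfl⟩; exact h.nti_le hba)

end LCAFacts

section DLCFacts

variable {A B D E : Type*} [CompleteBooleanAlgebra A] [CompleteBooleanAlgebra B]
  [CompleteBooleanAlgebra D] [CompleteBooleanAlgebra E]
  {ρ : A → A → Prop} {bA : Set A} {η : B → B → Prop} {bB : Set B}
  {σ : D → D → Prop} {bD : Set D} {τ : E → E → Prop} {bE : Set E}

theorem IsDLC.mono {ψ : A → B} (h : IsDLC ρ bA η bB ψ) : Monotone ψ := by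
  intro a b hab
  have := h.dlc2 a b
  rw [inf_eq_left.2 hab] at this
  exact this.le.trans inf_le_right

theorem IsDLC.dlc3' {ψ : A → B} (hA : IsLCA ρ bA) (hB : IsLCA η bB)
    (h : IsDLC ρ bA η bB ψ) {a b : A} (hab : NTI ρ a b) : NTI η (ψ aᶜ)ᶜ (ψ b) := by
  refine hB.nti_of_bdd fun c hc => ?_
  obtain ⟨e, he, hce⟩ := h.dlc4 c hc
  have h1 := h.dlc3 (a ⊓ e) b (hA.bb2 _ _ inf_le_right he) (hA.nti_mono inf_le_left le_rfl hab)
  refine hB.nti_mono ?_ le_rfl h1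
  rw [← disjoint_compl_right_iff, compl_compl, disjoint_iff, ← le_bot_iff]
  have h2 : ψ e ⊓ ψ (a ⊓ e)ᶜ ≤ ψ aᶜ := by
    rw [← h.dlc2]
    apply h.mono
    rw [compl_inf, inf_sup_left, inf_compl_eq_bot, sup_bot_eq]
    exact inf_le_right
  calc (ψ aᶜ)ᶜ ⊓ c ⊓ ψ (a ⊓ e)ᶜ ≤ (ψ aᶜ)ᶜ ⊓ (ψ e ⊓ ψ (a ⊓ e)ᶜ) := by
        rw [inf_assoc]; gcongr
    _ ≤ (ψ aᶜ)ᶜ ⊓ ψ aᶜ := by gcongr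
    _ = ⊥ := compl_inf_eq_bot

theorem IsDLC.nti {ψ : A → B} (hA : IsLCA ρ bA) (hB : IsLCA η bB)
    (h : IsDLC ρ bA η bB ψ) {a b : A} (hab : NTI ρ a b) : NTI η (ψ a) (ψ b) := by
  refine hB.nti_mono ?_ le_rfl (h.dlc3' hA hB hab)
  rw [← disjoint_compl_right_iff, compl_compl, disjoint_iff, ← h.dlc2, inf_compl_eq_bot, h.dlc1]

/-- A value `ψ x` is approximated from below by the values at bounded elements below `x`. -/
theorem IsDLC.le_of_bdd {ψ : A → B} (hA : IsLCA ρ bA)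
    (hB : IsLCA η bB) (h : IsDLC ρ bA η bB ψ) {x : A} {s : B}
    (hs : ∀ e ∈ bA, e ≤ x → ψ e ≤ s) : ψ x ≤ s := by
  refine (hB.sSup_nti (ψ x)).le.trans (sSup_le ?_)
  rintro z ⟨_, hz, hzx, rfl⟩
  obtain ⟨e, he, hze⟩ := h.dlc4 z hz
  have h1 : _ ≤ ψ (e ⊓ x) := (le_inf hze (hB.nti_le hzx)).trans (h.dlc2 e x).ge
  exact h1.trans (hs _ (hA.bb2 _ _ inf_le_left he) inf_le_right)

theorem IsDLC.id (hA : IsLCA ρ bA) : IsDLC ρ bA ρ bA (fun a => a) where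
  dlc1 := rfl
  dlc2 _ _ := rfl
  dlc3 a b _ hab := by rwa [compl_compl]
  dlc4 b hb := ⟨b, hb, le_rfl⟩
  dlc5 a := hA.sSup_nti a

theorem dlcComp_le {ψ₁ : A → B} {ψ₂ : B → D} (hA : IsLCA ρ bA)
    (h₁ : IsDLC ρ bA η bB ψ₁) (h₂ : IsDLC η bB σ bD ψ₂) (a : A) :
    dlcComp ρ bA ψ₂ ψ₁ a ≤ ψ₂ (ψ₁ a) :=
  sSup_le (by rintro _ ⟨b, -, hb, rfl⟩; exact h₂.mono (h₁.mono (hA.nti_le hb)))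

theorem le_dlcComp {ψ₁ : A → B} {ψ₂ : B → D} (hA : IsLCA ρ bA) (hB : IsLCA η bB)
    (hD : IsLCA σ bD) (h₁ : IsDLC ρ bA η bB ψ₁) (h₂ : IsDLC η bB σ bD ψ₂) {a b : A}
    (hab : NTI ρ a b) : ψ₂ (ψ₁ a) ≤ dlcComp ρ bA ψ₂ ψ₁ b := by
  refine h₂.le_of_bdd hB hD fun y hy hya => ?_
  obtain ⟨e, he, hye⟩ := h₁.dlc4 y hy
  have h3 : y ≤ ψ₁ (e ⊓ a) := by rw [h₁.dlc2]; exact le_inf hye hya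
  exact (h₂.mono h3).trans (le_sSup ⟨e ⊓ a, hA.bb2 _ _ inf_le_left he,
    hA.nti_mono inf_le_right le_rfl hab, rfl⟩)

theorem IsDLC.comp {ψ₁ : A → B} {ψ₂ : B → D} (hA : IsLCA ρ bA) (hB : IsLCA η bB)
    (hD : IsLCA σ bD) (h₁ : IsDLC ρ bA η bB ψ₁) (h₂ : IsDLC η bB σ bD ψ₂) :
    IsDLC ρ bA σ bD (dlcComp ρ bA ψ₂ ψ₁) where
  dlc1 := by
    have := dlcComp_le hA h₁ h₂ ⊥
    rwa [h₁.dlc1, h₂.dlc1, le_bot_iff] at this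
  dlc2 a b := by
    apply le_antisymm
    · refine sSup_le ?_
      rintro _ ⟨c, hc, hcab, rfl⟩
      exact le_inf (le_sSup ⟨c, hc, hA.nti_mono le_rfl inf_le_left hcab, rfl⟩)
        (le_sSup ⟨c, hc, hA.nti_mono le_rfl inf_le_right hcab, rfl⟩)
    · unfold dlcComp
      rw [sSup_inf_sSup]
      refine iSup₂_le ?_
      rintro ⟨_, _⟩ ⟨⟨c, hc, hca, rfl⟩, ⟨d, hd, hdb, rfl⟩⟩
      refine le_sSup ⟨c ⊓ d, hA.bb2 _ _ inf_le_left hc, hA.nti_inf hca hdb, ?_⟩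
      rw [h₁.dlc2, h₂.dlc2]
  dlc3 a b ha hab := by
    obtain ⟨c, hc, hac, hcb⟩ := hA.bc1 a b ha hab
    obtain ⟨d, hd, hcd, hdb⟩ := hA.bc1 c b hc hcb
    have h1 := h₂.dlc3' hB hD (h₁.dlc3 c d hc hcd)
    rw [compl_compl] at h1
    exact hD.nti_mono (compl_le_compl (le_dlcComp hA hB hD h₁ h₂ (hA.nti_compl hac)))
      (le_dlcComp hA hB hD h₁ h₂ hdb) h1
  dlc4 b hb := by
    obtain ⟨y, hy, hby⟩ := h₂.dlc4 b hb
    obtain ⟨z, hz, hyz⟩ := h₁.dlc4 y hy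
    obtain ⟨w, hw, hzw, -⟩ := hA.bc1 z ⊤ hz (hA.nti_top z)
    exact ⟨w, hw, (hby.trans (h₂.mono hyz)).trans (le_dlcComp hA hB hD h₁ h₂ hzw)⟩
  dlc5 a := by
    apply le_antisymm
    · refine sSup_le ?_
      rintro _ ⟨b, hb, hba, rfl⟩
      obtain ⟨c, hc, hbc, hca⟩ := hA.bc1 b a hb hba
      exact (le_dlcComp hA hB hD h₁ h₂ hbc).trans (le_sSup ⟨c, hc, hca, rfl⟩)
    · refine sSup_le ?_
      rintro _ ⟨b, hb, hba, rfl⟩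
      exact (dlcComp_le hA h₁ h₂ b).trans (le_sSup ⟨b, hb, hba, rfl⟩)

theorem dlcComp_id_right {ψ : A → B} (h : IsDLC ρ bA η bB ψ) :
    dlcComp ρ bA ψ (fun a => a) = ψ :=
  funext fun a => (h.dlc5 a).symm

theorem dlcComp_id_left {ψ : A → B} (h : IsDLC ρ bA η bB ψ) :
    dlcComp ρ bA (fun b => b) ψ = ψ :=
  funext fun a => (h.dlc5 a).symm

theorem dlcComp_assoc {ψ₁ : A → B} {ψ₂ : B → D} {ψ₃ : D → E} (hA : IsLCA ρ bA)
    (hB : IsLCA η bB) (hD : IsLCA σ bD) (hE : IsLCA τ bE) (h₁ : IsDLC ρ bA η bB ψ₁)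
    (h₂ : IsDLC η bB σ bD ψ₂) (h₃ : IsDLC σ bD τ bE ψ₃) :
    dlcComp ρ bA ψ₃ (dlcComp ρ bA ψ₂ ψ₁) = dlcComp ρ bA (dlcComp η bB ψ₃ ψ₂) ψ₁ := by
  funext a
  apply le_antisymm
  · refine sSup_le ?_
    rintro _ ⟨b, hb, hba, rfl⟩
    obtain ⟨c, hc, hbc, hca⟩ := hA.bc1 b a hb hba
    exact ((h₃.mono (dlcComp_le hA h₁ h₂ b)).trans
      (le_dlcComp hB hD hE h₂ h₃ (h₁.nti hA hB hbc))).trans (le_sSup ⟨c, hc, hca, rfl⟩)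
  · refine sSup_le ?_
    rintro _ ⟨b, hb, hba, rfl⟩
    obtain ⟨c, hc, hbc, hca⟩ := hA.bc1 b a hb hba
    exact ((dlcComp_le hB h₂ h₃ _).trans
      (h₃.mono (le_dlcComp hA hB hD h₁ h₂ hbc))).trans (le_sSup ⟨c, hc, hca, rfl⟩)

end DLCFacts

/-! ### Helper facts: MVD-algebras -/

/-- The contact relation of an MVD-algebra. -/
def mvdContact {B : Type*} [BooleanAlgebra B] (ll : B → B → Prop) (a b : B) : Prop :=
  ∃ c, ll c ⊤ ∧ ¬ ll (c ⊓ a) (c ⊓ b)ᶜ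

section MVDFacts

variable {B : Type*} [BooleanAlgebra B] {ll : B → B → Prop}

theorem nti_mvdContact {a b : B} :
    NTI (mvdContact ll) a b ↔ ∀ c, ll c ⊤ → ll (c ⊓ a) (cᶜ ⊔ b) := by
  simp [NTI, mvdContact, compl_inf]

theorem IsMVD.nti_of_ll {a b : B} (h : IsMVD ll) (hab : ll a b) : NTI (mvdContact ll) a b :=
  nti_mvdContact.2 fun _ _ => h.ll3 _ _ _ _ inf_le_right hab le_sup_right

theorem IsMVD.ll_of_nti {a b : B} (h : IsMVD ll) (ha : ll a ⊤)
    (hab : NTI (mvdContact ll) a b) : ll a b := by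
  obtain ⟨d, had, hd⟩ := h.ll5 _ _ ha
  have h1 := nti_mvdContact.1 hab d hd
  rw [inf_eq_right.2 (h.ll1 _ _ had)] at h1
  refine h.ll3 _ _ _ _ le_rfl (h.ll4' _ _ _ had h1) ?_
  rw [inf_sup_left, inf_compl_eq_bot, bot_sup_eq]
  exact inf_le_right

theorem IsMVD.ll_iff {a b : B} (h : IsMVD ll) :
    ll a b ↔ ll a ⊤ ∧ NTI (mvdContact ll) a b :=
  ⟨fun hab => ⟨h.ll3 _ _ _ _ le_rfl hab le_top, h.nti_of_ll hab⟩,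
    fun hab => h.ll_of_nti hab.1 hab.2⟩

theorem IsMVD.isLCA (h : IsMVD ll) : IsLCA (mvdContact ll) {a | ll a ⊤} where
  c1 a ha := by
    obtain ⟨b, hb0, hba⟩ := h.ll6 a ha
    refine ⟨b, h.ll3 _ _ _ _ le_rfl hba le_top, fun hl => hb0 ?_⟩
    have h1 := h.ll1 _ _ hl
    rw [inf_eq_left.2 (h.ll1 _ _ hba)] at h1
    have h2 := le_inf le_rfl h1
    rwa [inf_compl_eq_bot, le_bot_iff] at h2
  c2 a b := by
    rintro ⟨c, hc, hl⟩
    constructor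
    · rintro rfl
      exact hl (h.ll3 _ _ _ _ (by simp) h.ll2 bot_le)
    · rintro rfl
      exact hl (h.ll3 _ _ _ _ inf_le_left hc (by simp))
  c3 a b := by
    rintro ⟨c, hc, hl⟩
    refine ⟨c, hc, fun hl' => hl ?_⟩
    refine h.mvd _ _ (h.ll3 _ _ _ _ inf_le_left hc le_rfl) ?_
    rwa [compl_compl]
  c4 a b c := by
    constructor
    · rintro ⟨d, hd, hl⟩
      by_contra hcon
      simp only [mvdContact, not_or, not_exists, not_and, not_not] at hcon
      apply hl
      rw [inf_sup_left, compl_sup]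
      exact h.ll4' _ _ _ (hcon.1 d hd) (hcon.2 d hd)
    · rintro (⟨d, hd, hl⟩ | ⟨d, hd, hl⟩)
      · exact ⟨d, hd, fun hl' => hl (h.ll3 _ _ _ _ le_rfl hl'
          (compl_le_compl (inf_le_inf_left _ le_sup_left)))⟩
      · exact ⟨d, hd, fun hl' => hl (h.ll3 _ _ _ _ le_rfl hl'
          (compl_le_compl (inf_le_inf_left _ le_sup_right)))⟩
  bb1 := h.ll3 _ _ _ _ le_rfl h.ll2 le_top
  bb2 a b hab hb := h.ll3 _ _ _ _ hab hb le_rfl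
  bb3 a b ha hb := h.ll4 _ _ _ ha hb
  bc1 a c ha hac := by
    obtain ⟨b, hab, hbc⟩ := h.ll5 _ _ (h.ll_of_nti ha hac)
    exact ⟨b, h.ll3 _ _ _ _ le_rfl hbc le_top, h.nti_of_ll hab, h.nti_of_ll hbc⟩
  bc2 a b := by
    rintro ⟨c, hc, hl⟩
    refine ⟨c, hc, c, hc, ?_⟩
    rwa [← inf_assoc, inf_idem]
  bc3 a ha := by
    obtain ⟨b, hb0, hba⟩ := h.ll6 a ha
    exact ⟨b, h.ll3 _ _ _ _ le_rfl hba le_top, hb0, h.nti_of_ll hba⟩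

end MVDFacts

section MVDLCFacts

variable {A B D E : Type*} [CompleteBooleanAlgebra A] [CompleteBooleanAlgebra B]
  [CompleteBooleanAlgebra D]
  {llA : A → A → Prop} {llB : B → B → Prop}

theorem IsMVD.set_eq (hA : IsMVD llA) (f : A → E) (a : A) :
    {x | ∃ b, llA b a ∧ x = f b} =
      {x | ∃ b ∈ {b | llA b ⊤}, NTI (mvdContact llA) b a ∧ x = f b} := by
  ext x
  simp only [Set.mem_ofPred_eq]
  exact exists_congr fun b => by rw [hA.ll_iff, and_assoc]

theorem mvdComp_eq {C : Type*} (hA : IsMVD llA) (ψ₂ : C → D) (ψ₁ : A → C) :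
    mvdComp llA ψ₂ ψ₁ = dlcComp (mvdContact llA) {a | llA a ⊤} ψ₂ ψ₁ := by
  funext a
  unfold mvdComp dlcComp
  rw [hA.set_eq]

theorem isMVDLC_iff (hA : IsMVD llA) {ψ : A → B} :
    IsMVDLC llA llB ψ ↔
      IsDLC (mvdContact llA) {a | llA a ⊤} (mvdContact llB) {b | llB b ⊤} ψ := by
  constructor
  · intro h
    refine ⟨h.mvdlc1, h.mvdlc2, fun a b ha hab => nti_mvdContact.2 fun c hc => ?_, h.mvdlc4,
      fun a => ?_⟩
    · have := h.mvdlc3 a b (hA.ll_of_nti ha hab) c hc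
      rwa [inf_comm, sup_comm] at this
    · rw [← hA.set_eq]; exact h.mvdlc5 a
  · intro h
    refine ⟨h.dlc1, h.dlc2, fun a b hab c hc => ?_, h.dlc4, fun a => ?_⟩
    · have h1 := hA.ll_iff.1 hab
      have := nti_mvdContact.1 (h.dlc3 a b h1.1 h1.2) c hc
      rwa [inf_comm, sup_comm] at this
    · rw [hA.set_eq]; exact h.dlc5 a

end MVDLCFacts

/-! ### The categories -/

/-- Objects of **DHLC**: complete local contact algebras. -/
structure DHLC : Type (u + 1) where
  carrier : Type u
  [str : CompleteBooleanAlgebra carrier]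
  contact : carrier → carrier → Prop
  bdd : Set carrier
  isLCA : IsLCA contact bdd

attribute [instance] DHLC.str

/-- Morphisms of **DHLC**. -/
@[ext]
structure DHLC.Hom (X Y : DHLC.{u}) : Type u where
  toFun : X.carrier → Y.carrier
  isDLC : IsDLC X.contact X.bdd Y.contact Y.bdd toFun

/-- The category **DHLC**, with composition `⊙` (in diagrammatic order, `f ≫ g = g ⊙ f`). -/
instance DHLC.category : Category.{u} DHLC.{u} where
  Hom := DHLC.Hom
  id X := ⟨fun a => a, IsDLC.id X.isLCA⟩
  comp {X Y Z} f g :=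
    ⟨dlcComp X.contact X.bdd g.toFun f.toFun,
      IsDLC.comp X.isLCA Y.isLCA Z.isLCA f.isDLC g.isDLC⟩
  id_comp f := DHLC.Hom.ext (dlcComp_id_right f.isDLC)
  comp_id f := DHLC.Hom.ext (dlcComp_id_left f.isDLC)
  assoc {W X Y Z} f g h := DHLC.Hom.ext
    (dlcComp_assoc W.isLCA X.isLCA Y.isLCA Z.isLCA f.isDLC g.isDLC h.isDLC)

/-- Objects of **MVDHLC**: complete MVD-algebras. -/
structure MVDHLC : Type (u + 1) where
  carrier : Type u
  [str : CompleteBooleanAlgebra carrier]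
  ll : carrier → carrier → Prop
  isMVD : IsMVD ll

attribute [instance] MVDHLC.str

/-- Morphisms of **MVDHLC**. -/
@[ext]
structure MVDHLC.Hom (X Y : MVDHLC.{u}) : Type u where
  toFun : X.carrier → Y.carrier
  isMVDLC : IsMVDLC X.ll Y.ll toFun

/-- The category **MVDHLC**, with composition `⊚` (in diagrammatic order, `f ≫ g = g ⊚ f`). -/
instance MVDHLC.category : Category.{u} MVDHLC.{u} where
  Hom := MVDHLC.Hom
  id X := ⟨fun a => a, (isMVDLC_iff X.isMVD).2 (IsDLC.id X.isMVD.isLCA)⟩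
  comp {X Y Z} f g :=
    ⟨mvdComp X.ll g.toFun f.toFun, by
      rw [isMVDLC_iff X.isMVD, mvdComp_eq X.isMVD]
      exact IsDLC.comp X.isMVD.isLCA Y.isMVD.isLCA Z.isMVD.isLCA
        ((isMVDLC_iff X.isMVD).1 f.isMVDLC) ((isMVDLC_iff Y.isMVD).1 g.isMVDLC)⟩
  id_comp {X Y} f := MVDHLC.Hom.ext
    ((mvdComp_eq X.isMVD _ _).trans (dlcComp_id_right ((isMVDLC_iff X.isMVD).1 f.isMVDLC)))
  comp_id {X Y} f := MVDHLC.Hom.ext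
    ((mvdComp_eq X.isMVD _ _).trans (dlcComp_id_left ((isMVDLC_iff X.isMVD).1 f.isMVDLC)))
  assoc {W X Y Z} f g h := MVDHLC.Hom.ext (by
    simp only [mvdComp_eq W.isMVD, mvdComp_eq X.isMVD]
    exact dlcComp_assoc W.isMVD.isLCA X.isMVD.isLCA Y.isMVD.isLCA Z.isMVD.isLCA
      ((isMVDLC_iff W.isMVD).1 f.isMVDLC) ((isMVDLC_iff X.isMVD).1 g.isMVDLC)
      ((isMVDLC_iff Y.isMVD).1 h.isMVDLC))

/-- The category **HLC** of locally compact Hausdorff spaces and all continuous maps. -/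
abbrev HLC : Type (u + 1) :=
  ObjectProperty.FullSubcategory
    (fun X : TopCat.{u} => T2Space X ∧ LocallyCompactSpace X)

/-! A local contact algebra and an MVD-algebra are the same structure on one Boolean algebra. The
pair `(ρ, bdd)` is packed into the single relation "`a` is bounded and `a ≪ b`" (`bddNTI`). From it
the bounded elements return as those `≪ ⊤`, and `ρ` returns through `mvdContact`, because by (BC2)
contact is detected on bounded elements. Under this dictionary the two morphism conditions agree and
so do the two compositions, so both functors keep the underlying functions and are strictly inverse
to each other.

For the duality it then suffices that regular open sets give an equivalence `HLCᵒᵖ ≌ DHLC`, with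
contact meaning that closures meet and bounded meaning compact closure. The main tool is an abstract
point: a round filter with a bounded member that decides every pair `a ≪ b`. Every nonzero element
lies in a point (`exists_isPoint_mem`), and the points form a locally compact Hausdorff space whose
regular open sets recover a complete algebra (`PointSpace.orderIso`), whence essential surjectivity.
In the algebra of a space, abstract points are actual points (`exists_of_isPoint`), so a morphism
`ψ` induces a continuous map by pulling points back, whence fullness (`exists_comap_eq`).
Faithfulness is Hausdorff separation. -/

section Isomorphism

/-! ### The strict isomorphism between the two kinds of algebras -/

/-- The relation `≪` of the MVD-algebra attached to a local contact algebra. -/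
def bddNTI {B : Type*} [BooleanAlgebra B] (ρ : B → B → Prop) (bdd : Set B) (a b : B) : Prop :=
  a ∈ bdd ∧ NTI ρ a b

theorem IsContact.nti_sup_left {B : Type*} [BooleanAlgebra B] {ρ : B → B → Prop} {a b c : B}
    (h : IsContact ρ) (ha : NTI ρ a c) (hb : NTI ρ b c) : NTI ρ (a ⊔ b) c := by
  intro hc
  rcases (h.c4 _ _ _).1 (h.c3 _ _ hc) with h1 | h1
  · exact ha (h.c3 _ _ h1)
  · exact hb (h.c3 _ _ h1)

theorem IsContact.nti_bot {B : Type*} [BooleanAlgebra B] {ρ : B → B → Prop}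
    (h : IsContact ρ) (a : B) : NTI ρ ⊥ a :=
  fun hc => (h.c2 _ _ hc).1 rfl

variable {B : Type*} [BooleanAlgebra B] {ρ : B → B → Prop} {bdd : Set B}

theorem IsLCA.isMVD (h : IsLCA ρ bdd) : IsMVD (bddNTI ρ bdd) where
  ll1 _ _ hab := h.nti_le hab.2
  ll2 := ⟨h.bb1, h.nti_bot _⟩
  ll3 _ _ _ _ hab hbc hct := ⟨h.bb2 _ _ hab hbc.1, h.nti_mono hab hct hbc.2⟩
  ll4 _ _ _ ha hb := ⟨h.bb3 _ _ ha.1 hb.1, h.nti_sup_left ha.2 hb.2⟩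
  ll5 a c hac := by
    obtain ⟨b, hb, hab, hbc⟩ := h.bc1 a c hac.1 hac.2
    exact ⟨b, ⟨hac.1, hab⟩, hb, hbc⟩
  ll6 a ha := by
    obtain ⟨b, hb, hb0, hba⟩ := h.bc3 a ha
    exact ⟨b, hb0, hb, hba⟩
  ll4' _ _ _ hb hc := ⟨hb.1, h.nti_inf_right hb.2 hc.2⟩
  mvd a b ha hba := ⟨ha.1, by simpa using h.nti_compl hba.2⟩

theorem IsLCA.bddNTI_top (h : IsLCA ρ bdd) : {a | bddNTI ρ bdd a ⊤} = bdd :=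
  Set.ext fun _ => ⟨fun ha => ha.1, fun ha => ⟨ha, h.nti_top _⟩⟩

theorem IsLCA.mvdContact_bddNTI (h : IsLCA ρ bdd) : mvdContact (bddNTI ρ bdd) = ρ := by
  have key : ∀ a b, NTI (mvdContact (bddNTI ρ bdd)) a b ↔ NTI ρ a b := by
    intro a b
    rw [nti_mvdContact]
    constructor
    · refine fun hab => h.nti_of_bdd fun c hc => ?_
      -- The hypothesis is tested on `d ≫ c` instead of `c`: since `c ≪ d`, the surplus `dᶜ` in its
      -- conclusion is removed by meeting with `d`.
      obtain ⟨d, hd, hcd, -⟩ := h.bc1 c ⊤ hc (h.nti_top c)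
      have h1 := (hab d ⟨hd, h.nti_top d⟩).2
      have h2 : NTI ρ (a ⊓ c) (dᶜ ⊔ b) :=
        h.nti_mono (by rw [inf_comm]; exact inf_le_inf_right _ (h.nti_le hcd)) le_rfl h1
      refine h.nti_mono le_rfl ?_
        (h.nti_inf_right (h.nti_mono inf_le_right le_rfl hcd) h2)
      rw [inf_sup_left, inf_compl_eq_bot, bot_sup_eq]
      exact inf_le_right
    · exact fun hab c hc => ⟨h.bb2 _ _ inf_le_left hc.1,
        h.nti_mono inf_le_right le_sup_right hab⟩
  funext a b
  simpa [NTI, not_iff_not] using key a bᶜ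

theorem IsMVD.bddNTI_mvdContact {ll : B → B → Prop} (h : IsMVD ll) :
    bddNTI (mvdContact ll) {a | ll a ⊤} = ll := by
  funext a b
  exact propext h.ll_iff.symm

theorem IsLCA.isMVDLC_iff {A B : Type*} [CompleteBooleanAlgebra A] [CompleteBooleanAlgebra B]
    {ρ : A → A → Prop} {bA : Set A} {η : B → B → Prop} {bB : Set B}
    (hA : IsLCA ρ bA) (hB : IsLCA η bB) {ψ : A → B} :
    IsMVDLC (bddNTI ρ bA) (bddNTI η bB) ψ ↔ IsDLC ρ bA η bB ψ := by
  rw [_root_.isMVDLC_iff hA.isMVD, hA.mvdContact_bddNTI, hB.mvdContact_bddNTI, hA.bddNTI_top,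
    hB.bddNTI_top]

/-- The functor **DHLC** ⥤ **MVDHLC**. -/
def DHLC.toMVDHLC : DHLC.{u} ⥤ MVDHLC.{u} where
  obj X := ⟨X.carrier, bddNTI X.contact X.bdd, X.isLCA.isMVD⟩
  map {X Y} f := ⟨f.toFun, (X.isLCA.isMVDLC_iff Y.isLCA).2 f.isDLC⟩
  map_id _ := rfl
  map_comp {X _ _} f g := MVDHLC.Hom.ext <| by
    change dlcComp X.contact X.bdd g.toFun f.toFun =
      mvdComp (bddNTI X.contact X.bdd) g.toFun f.toFun
    rw [mvdComp_eq X.isLCA.isMVD, X.isLCA.mvdContact_bddNTI, X.isLCA.bddNTI_top]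

/-- The functor **MVDHLC** ⥤ **DHLC**. -/
def MVDHLC.toDHLC : MVDHLC.{u} ⥤ DHLC.{u} where
  obj X := ⟨X.carrier, mvdContact X.ll, {a | X.ll a ⊤}, X.isMVD.isLCA⟩
  map {X _} f := ⟨f.toFun, (isMVDLC_iff X.isMVD).1 f.isMVDLC⟩
  map_id _ := rfl
  map_comp {X _ _} _ _ := DHLC.Hom.ext (mvdComp_eq X.isMVD _ _)

/-- The round trip changes the relations only up to propositional equality, so morphisms are
compared by `HEq`; with the relations as variables, `subst` applies. -/
theorem DHLC.hom_mk_heq {A B : Type u} [CompleteBooleanAlgebra A] [CompleteBooleanAlgebra B]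
    {ρ ρ' : A → A → Prop} {bA bA' : Set A} {η η' : B → B → Prop} {bB bB' : Set B}
    {hA : IsLCA ρ bA} {hA' : IsLCA ρ' bA'} {hB : IsLCA η bB} {hB' : IsLCA η' bB'}
    (hρ : ρ = ρ') (hbA : bA = bA') (hη : η = η') (hbB : bB = bB') {ψ : A → B}
    (h : IsDLC ρ bA η bB ψ) (h' : IsDLC ρ' bA' η' bB' ψ) :
    HEq (⟨ψ, h⟩ : DHLC.Hom ⟨A, ρ, bA, hA⟩ ⟨B, η, bB, hB⟩)
      (⟨ψ, h'⟩ : DHLC.Hom ⟨A, ρ', bA', hA'⟩ ⟨B, η', bB', hB'⟩) := by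
  subst hρ hbA hη hbB
  rfl

theorem MVDHLC.hom_mk_heq {A B : Type u} [CompleteBooleanAlgebra A] [CompleteBooleanAlgebra B]
    {llA llA' : A → A → Prop} {llB llB' : B → B → Prop}
    {hA : IsMVD llA} {hA' : IsMVD llA'} {hB : IsMVD llB} {hB' : IsMVD llB'}
    (hllA : llA = llA') (hllB : llB = llB') {ψ : A → B}
    (h : IsMVDLC llA llB ψ) (h' : IsMVDLC llA' llB' ψ) :
    HEq (⟨ψ, h⟩ : MVDHLC.Hom ⟨A, llA, hA⟩ ⟨B, llB, hB⟩)
      (⟨ψ, h'⟩ : MVDHLC.Hom ⟨A, llA', hA'⟩ ⟨B, llB', hB'⟩) := by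
  subst hllA hllB
  rfl

theorem DHLC.toMVDHLC_comp_toDHLC : DHLC.toMVDHLC ⋙ MVDHLC.toDHLC = 𝟭 DHLC.{u} := by
  refine Functor.hext (fun X => ?_) (fun X Y f => ?_)
  · obtain ⟨A, ρ, bdd, h⟩ := X
    simp only [Functor.comp_obj, toMVDHLC, MVDHLC.toDHLC, Functor.id_obj,
      h.mvdContact_bddNTI, h.bddNTI_top]
  · exact DHLC.hom_mk_heq X.isLCA.mvdContact_bddNTI X.isLCA.bddNTI_top
      Y.isLCA.mvdContact_bddNTI Y.isLCA.bddNTI_top _ f.isDLC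

theorem MVDHLC.toDHLC_comp_toMVDHLC : MVDHLC.toDHLC ⋙ DHLC.toMVDHLC = 𝟭 MVDHLC.{u} := by
  refine Functor.hext (fun X => ?_) (fun X Y f => ?_)
  · obtain ⟨A, ll, h⟩ := X
    simp only [Functor.comp_obj, toDHLC, DHLC.toMVDHLC, Functor.id_obj, h.bddNTI_mvdContact]
  · exact MVDHLC.hom_mk_heq X.isMVD.bddNTI_mvdContact Y.isMVD.bddNTI_mvdContact _ f.isMVDLC

end Isomorphism

/-! ### The local contact algebra of regular open sets -/

section RegularOpens

open Heyting TopologicalSpace Topology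

/-- Double negation is a Galois insertion onto the regular elements, so bounds transfer from the
frame. A meet of regular elements is already regular; only joins are really changed by `toRegular`.
-/
noncomputable instance Heyting.Regular.instCompleteBooleanAlgebra {α : Type*} [Order.Frame α] :
    CompleteBooleanAlgebra (Heyting.Regular α) where
  __ := (inferInstance : BooleanAlgebra (Heyting.Regular α))
  sSup S := Regular.toRegular (sSup (Regular.val '' S))
  sInf S := Regular.toRegular (sInf (Regular.val '' S))
  isLUB_sSup _ := Regular.gi.isLUB_of_u_image (isLUB_sSup _)
  isGLB_sInf _ := Regular.gi.isGLB_of_u_image (isGLB_sInf _)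

/-- The complete Boolean algebra of regular open subsets of a topological space. -/
abbrev RegularOpens (X : Type*) [TopologicalSpace X] : Type _ := Heyting.Regular (Opens X)

namespace RegularOpens

variable {X : Type*} [TopologicalSpace X]

/-- The underlying set of a regular open set. -/
def set (U : RegularOpens X) : Set X := (U.val : Set X)

theorem isOpen (U : RegularOpens X) : IsOpen U.set := U.val.isOpen

theorem set_injective : Function.Injective (set : RegularOpens X → Set X) :=
  fun _ _ h => Regular.coe_injective (Opens.ext h)

theorem set_subset_set {U V : RegularOpens X} : U.set ⊆ V.set ↔ U ≤ V := Iff.rfl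

theorem set_bot : (⊥ : RegularOpens X).set = ∅ := rfl

theorem set_compl (U : RegularOpens X) : Uᶜ.set = (closure U.set)ᶜ :=
  Opens.coe_compl_eq_interior_compl.trans interior_compl

theorem coe_compl_compl (W : Opens X) : ((Wᶜᶜ : Opens X) : Set X) = interior (closure W) := by
  rw [Opens.coe_compl_eq_interior_compl, Opens.coe_compl_eq_interior_compl, interior_compl,
    interior_compl, closure_compl, compl_compl]

theorem interior_closure_set (U : RegularOpens X) : interior (closure U.set) = U.set := by
  conv_rhs => rw [set, ← U.prop.eq, coe_compl_compl]
  rfl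

/-- The regularization of a set: the interior of its closure. -/
def ofSet (W : Set X) : RegularOpens X :=
  ⟨⟨interior (closure W), isOpen_interior⟩, by
    refine Opens.ext ((coe_compl_compl _).trans ?_)
    exact interior_closure_idem⟩

theorem set_ofSet (W : Set X) : (ofSet W).set = interior (closure W) := rfl

theorem subset_set_ofSet {W : Set X} (hW : IsOpen W) : W ⊆ (ofSet W).set :=
  interior_maximal subset_closure hW

theorem closure_set_ofSet {W : Set X} (hW : IsOpen W) : closure (ofSet W).set = closure W :=
  subset_antisymm (closure_minimal interior_subset isClosed_closure)
    (closure_mono (subset_set_ofSet hW))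

theorem ofSet_set (U : RegularOpens X) : ofSet U.set = U :=
  set_injective U.interior_closure_set

theorem ofSet_mono {V W : Set X} (h : V ⊆ W) : ofSet V ≤ ofSet W :=
  set_subset_set.1 (interior_mono (closure_mono h))

/-- On open sets, interior of closure is double negation in the frame of opens, which preserves
finite meets. -/
theorem ofSet_inter {V W : Set X} (hV : IsOpen V) (hW : IsOpen W) :
    ofSet (V ∩ W) = ofSet V ⊓ ofSet W := by
  refine Regular.coe_injective ?_
  have h : ∀ Z : Opens X, (ofSet (Z : Set X)).val = Zᶜᶜ := fun Z =>
    Opens.ext (coe_compl_compl Z).symm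
  have h1 := compl_compl_inf_distrib (⟨V, hV⟩ : Opens X) ⟨W, hW⟩
  rw [← h, ← h, ← h] at h1
  exact h1

theorem sup_eq_ofSet (U V : RegularOpens X) : U ⊔ V = ofSet (U.set ∪ V.set) :=
  set_injective (coe_compl_compl (U.val ⊔ V.val))

theorem sSup_eq_ofSet (S : Set (RegularOpens X)) : sSup S = ofSet (⋃ U ∈ S, U.set) := by
  refine set_injective ((coe_compl_compl (sSup (Regular.val '' S))).trans ?_)
  rw [set_ofSet, Opens.coe_sSup, Set.biUnion_image]
  rfl

theorem closure_set_sup (U V : RegularOpens X) :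
    closure (U ⊔ V).set = closure U.set ∪ closure V.set := by
  rw [sup_eq_ofSet, closure_set_ofSet (U.isOpen.union V.isOpen), closure_union]

/-- The standard contact relation: the closures meet. -/
def Contact (U V : RegularOpens X) : Prop := (closure U.set ∩ closure V.set).Nonempty

/-- As `V` is regular, the closure of `Vᶜ` is exactly the set complement of `V`. -/
theorem nti_contact {U V : RegularOpens X} : NTI Contact U V ↔ closure U.set ⊆ V.set := by
  rw [NTI, Contact, Set.not_nonempty_iff_eq_empty, ← Set.disjoint_iff_inter_eq_empty,
    ← Set.subset_compl_iff_disjoint_right, ← interior_compl, set_compl, interior_compl.symm,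
    ← interior_closure_set V]
  simp

variable (X) in
/-- The bounded regular open sets: those with compact closure. -/
def bounded : Set (RegularOpens X) := {U | IsCompact (closure U.set)}

variable [T2Space X] [LocallyCompactSpace X]

theorem exists_between {K W : Set X} (hK : IsCompact K) (hW : IsOpen W) (h : K ⊆ W) :
    ∃ V ∈ bounded X, K ⊆ V.set ∧ closure V.set ⊆ W := by
  obtain ⟨V, hV, hKV, hVW, hc⟩ := exists_open_between_and_isCompact_closure hK hW h
  refine ⟨ofSet V, ?_, hKV.trans (subset_set_ofSet hV), ?_⟩
  · rwa [bounded, Set.mem_ofPred_eq, closure_set_ofSet hV]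
  · rwa [closure_set_ofSet hV]

theorem exists_mem_between {x : X} {W : Set X} (hW : IsOpen W) (h : x ∈ W) :
    ∃ V ∈ bounded X, x ∈ V.set ∧ closure V.set ⊆ W := by
  simpa using exists_between isCompact_singleton hW (Set.singleton_subset_iff.2 h)

variable (X) in
theorem isLCA : IsLCA (Contact (X := X)) (bounded X) where
  c1 U hU := by
    rw [Contact, Set.inter_self, closure_nonempty_iff, Set.nonempty_iff_ne_empty]
    exact fun h => hU (set_injective h)
  c2 U V h := by
    constructor <;> rintro rfl <;> simp [Contact, set_bot] at h
  c3 U V h := by rwa [Contact, Set.inter_comm]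
  c4 U V W := by
    rw [Contact, closure_set_sup, Set.inter_union_distrib_left, Set.union_nonempty]
    rfl
  bb1 := by simp [bounded, set_bot]
  bb2 U V h hV := hV.of_isClosed_subset isClosed_closure (closure_mono (set_subset_set.2 h))
  bb3 U V hU hV := by
    rw [bounded, Set.mem_ofPred_eq, closure_set_sup]
    exact hU.union hV
  bc1 U W hU hUW := by
    obtain ⟨V, hV, h1, h2⟩ := exists_between hU W.isOpen (nti_contact.1 hUW)
    exact ⟨V, hV, nti_contact.2 h1, nti_contact.2 h2⟩
  bc2 U V := by
    rintro ⟨x, hxU, hxV⟩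
    obtain ⟨W, hW, hxW, -⟩ := exists_mem_between isOpen_univ (Set.mem_univ x)
    exact ⟨W, hW, x, hxU, W.isOpen.inter_closure ⟨hxW, hxV⟩⟩
  bc3 U hU := by
    obtain ⟨x, hx⟩ : U.set.Nonempty :=
      Set.nonempty_iff_ne_empty.2 fun h => hU (set_injective h)
    obtain ⟨V, hV, hxV, hVU⟩ := exists_mem_between U.isOpen hx
    refine ⟨V, hV, ?_, nti_contact.2 hVU⟩
    rintro rfl
    exact hxV

end RegularOpens

end RegularOpens

/-! ### Points of a local contact algebra and the space they form -/

section Points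

open TopologicalSpace Topology

variable {B : Type*} [BooleanAlgebra B] {ρ : B → B → Prop} {bdd : Set B}

/-- A proper bounded filter of a local contact algebra that decides every pair `a ≪ b`. -/
structure IsDecidingFilter (ρ : B → B → Prop) (bdd : Set B) (u : Set B) : Prop where
  bot_notMem : ⊥ ∉ u
  mem_of_le : ∀ {a b}, a ≤ b → a ∈ u → b ∈ u
  inf_mem : ∀ {a b}, a ∈ u → b ∈ u → a ⊓ b ∈ u
  exists_bdd : ∃ a ∈ u, a ∈ bdd
  compl_mem_or : ∀ {a b}, NTI ρ a b → aᶜ ∈ u ∨ b ∈ u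

variable (ρ bdd) in
/-- The elements that are well above a bounded element of `u`. -/
def roundPart (u : Set B) : Set B := {a | ∃ b ∈ u, b ∈ bdd ∧ NTI ρ b a}

/-- A deciding filter whose members are well above bounded members: the abstract form of a point
of a locally compact Hausdorff space. -/
structure IsPoint (ρ : B → B → Prop) (bdd : Set B) (u : Set B) : Prop
    extends IsDecidingFilter ρ bdd u where
  round : u ⊆ roundPart ρ bdd u

theorem roundPart_subset (h : IsLCA ρ bdd) {u : Set B} (hu : IsDecidingFilter ρ bdd u) :
    roundPart ρ bdd u ⊆ u := by
  rintro a ⟨b, hb, -, hba⟩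
  exact hu.mem_of_le (h.nti_le hba) hb

theorem IsDecidingFilter.isPoint (h : IsLCA ρ bdd) {u : Set B} (hu : IsDecidingFilter ρ bdd u) :
    IsPoint ρ bdd (roundPart ρ bdd u) where
  bot_notMem hb := hu.bot_notMem (roundPart_subset h hu hb)
  mem_of_le := by
    rintro a b hab ⟨c, hc, hcb, hca⟩
    exact ⟨c, hc, hcb, h.nti_mono le_rfl hab hca⟩
  inf_mem := by
    rintro a b ⟨c, hc, hcb, hca⟩ ⟨d, hd, -, hdb⟩
    exact ⟨c ⊓ d, hu.inf_mem hc hd, h.bb2 _ _ inf_le_left hcb, h.nti_inf hca hdb⟩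
  exists_bdd := by
    obtain ⟨a, ha, hab⟩ := hu.exists_bdd
    obtain ⟨b, hb, hab', -⟩ := h.bc1 a ⊤ hab (h.nti_top a)
    exact ⟨b, ⟨a, ha, hab, hab'⟩, hb⟩
  compl_mem_or := by
    intro a b hab
    -- (BC1) interpolates only below bounded elements, so `a` is first cut down by `c' ≫ c` with `c
    -- ∈ u`. In the chain `c' ⊓ a ≪ d ≪ d' ≪ b` the filter decides the middle pair, and the outer
    -- ones provide roundness.
    obtain ⟨c, hc, hcb⟩ := hu.exists_bdd
    obtain ⟨c', hc'b, hcc', -⟩ := h.bc1 c ⊤ hcb (h.nti_top c)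
    obtain ⟨d, hdb, had, hd⟩ := h.bc1 (c' ⊓ a) b (h.bb2 _ _ inf_le_left hc'b)
      (h.nti_mono inf_le_right le_rfl hab)
    obtain ⟨d', hd'b, hdd', hd'⟩ := h.bc1 d b hdb hd
    rcases hu.compl_mem_or hdd' with h1 | h1
    · refine Or.inl ⟨c ⊓ dᶜ, hu.inf_mem hc h1, h.bb2 _ _ inf_le_left hcb, ?_⟩
      refine h.nti_mono le_rfl ?_ (h.nti_inf hcc' (h.nti_compl had))
      rw [compl_inf, inf_sup_left, inf_compl_eq_bot, bot_sup_eq]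
      exact inf_le_right
    · exact Or.inr ⟨d', h1, hd'b, hd'⟩
  round := by
    rintro a ⟨b, hb, hbb, hba⟩
    obtain ⟨c, hcb, hbc, hca⟩ := h.bc1 b a hbb hba
    exact ⟨c, ⟨b, hb, hbb, hbc⟩, hcb, hca⟩

theorem IsPoint.top_mem {p : Set B} (hp : IsPoint ρ bdd p) : ⊤ ∈ p := by
  obtain ⟨a, ha, -⟩ := hp.exists_bdd
  exact hp.mem_of_le le_top ha

theorem IsPoint.disjoint_compl {p : Set B} (hp : IsPoint ρ bdd p) {a : B} (ha : a ∈ p) :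
    aᶜ ∉ p :=
  fun h => hp.bot_notMem (by simpa using hp.inf_mem ha h)

/-- Points form an antichain, so distinct points differ in a prescribed direction; this is what
Hausdorff separation needs. -/
theorem IsPoint.eq_of_subset {p q : Set B} (hp : IsPoint ρ bdd p) (hq : IsPoint ρ bdd q)
    (h : p ⊆ q) : p = q := by
  refine h.antisymm fun a ha => ?_
  obtain ⟨b, hb, -, hba⟩ := hq.round ha
  exact (hp.compl_mem_or hba).resolve_left fun h1 => hq.disjoint_compl hb (h h1)

/-- If `b ≪ c` then `bᶜ ⊔ c = ⊤`, so both cannot lie in a proper ideal. -/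
theorem Order.Ideal.IsPrime.isDecidingFilter (h : IsLCA ρ bdd) {I : Order.Ideal B}
    (hI : I.IsPrime) {a : B} (ha : a ∈ bdd) (haI : a ∉ I) :
    IsDecidingFilter ρ bdd {b | b ∉ I} where
  bot_notMem hb := hb I.bot_mem
  mem_of_le hab hA hb := hA (I.lower hab hb)
  inf_mem hA hB hab := (hI.mem_or_mem hab).elim hA hB
  exists_bdd := ⟨a, haI, ha⟩
  compl_mem_or := by
    intro b c hbc
    by_contra! hcon
    simp only [Set.mem_ofPred_eq, not_not] at hcon
    refine haI (I.lower ?_ (Order.Ideal.sup_mem hcon.1 hcon.2))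
    exact le_top.trans ((compl_sup_eq_top (x := b)).ge.trans (sup_le_sup_left (h.nti_le hbc) _))

theorem exists_isPoint_mem (h : IsLCA ρ bdd) {a : B} (ha : a ≠ ⊥) :
    ∃ p, IsPoint ρ bdd p ∧ a ∈ p := by
  -- Avoiding `b ≪ a` by the prime ideal, and not merely `a`, puts `a` in the round part.
  obtain ⟨b, hb, hb0, hba⟩ := h.bc3 a ha
  obtain ⟨I, hI, -, hdisj⟩ := DistribLattice.prime_ideal_of_disjoint_filter_ideal
    (F := Order.PFilter.principal b) (I := (⊥ : Order.Ideal B)) <| by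
      rw [Set.disjoint_left]
      intro x hx hx'
      have h1 : b ≤ x := hx
      have h2 : x = ⊥ := le_bot_iff.1 hx'
      exact hb0 (le_bot_iff.1 (h2 ▸ h1))
  have hbI : b ∉ I := Set.disjoint_left.1 hdisj (show b ≤ b from le_rfl)
  exact ⟨_, (hI.isDecidingFilter h hb hbI).isPoint h, b, hbI, hb, hba⟩

variable (ρ bdd) in
/-- The space of points of a local contact algebra. -/
def PointSpace : Type _ := {p : Set B // IsPoint ρ bdd p}

namespace PointSpace

variable (ρ bdd) in
/-- The basic open set of all points containing `a`. -/
def basicOpen (a : B) : Set (PointSpace ρ bdd) := {p | a ∈ p.1}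

theorem mem_basicOpen {a : B} {p : PointSpace ρ bdd} : p ∈ basicOpen ρ bdd a ↔ a ∈ p.1 := Iff.rfl

theorem basicOpen_mono {a b : B} (h : a ≤ b) : basicOpen ρ bdd a ⊆ basicOpen ρ bdd b :=
  fun p => p.2.mem_of_le h

theorem basicOpen_inf (a b : B) :
    basicOpen ρ bdd (a ⊓ b) = basicOpen ρ bdd a ∩ basicOpen ρ bdd b :=
  Set.ext fun p => ⟨fun h => ⟨p.2.mem_of_le inf_le_left h, p.2.mem_of_le inf_le_right h⟩,
    fun h => p.2.inf_mem h.1 h.2⟩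

instance : TopologicalSpace (PointSpace ρ bdd) where
  IsOpen W := ∀ p ∈ W, ∃ a ∈ p.1, basicOpen ρ bdd a ⊆ W
  isOpen_univ p _ := ⟨⊤, p.2.top_mem, Set.subset_univ _⟩
  isOpen_inter V W hV hW p hp := by
    obtain ⟨a, ha, haV⟩ := hV p hp.1
    obtain ⟨b, hb, hbW⟩ := hW p hp.2
    refine ⟨a ⊓ b, p.2.inf_mem ha hb, ?_⟩
    rw [basicOpen_inf]
    exact Set.inter_subset_inter haV hbW
  isOpen_sUnion S hS p := by
    rintro ⟨W, hW, hp⟩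
    obtain ⟨a, ha, haW⟩ := hS W hW p hp
    exact ⟨a, ha, haW.trans (Set.subset_sUnion_of_mem hW)⟩

theorem isOpen_iff {W : Set (PointSpace ρ bdd)} :
    IsOpen W ↔ ∀ p ∈ W, ∃ a ∈ p.1, basicOpen ρ bdd a ⊆ W := Iff.rfl

theorem isOpen_basicOpen (a : B) : IsOpen (basicOpen ρ bdd a) := fun _ hp => ⟨a, hp, subset_rfl⟩

theorem mem_nhds_iff {p : PointSpace ρ bdd} {W : Set (PointSpace ρ bdd)} :
    W ∈ 𝓝 p ↔ ∃ a ∈ p.1, basicOpen ρ bdd a ⊆ W := by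
  rw [_root_.mem_nhds_iff]
  constructor
  · rintro ⟨V, hVW, hV, hp⟩
    obtain ⟨a, ha, haV⟩ := hV p hp
    exact ⟨a, ha, haV.trans hVW⟩
  · rintro ⟨a, ha, haW⟩
    exact ⟨_, haW, isOpen_basicOpen a, ha⟩

theorem le_of_basicOpen_subset (h : IsLCA ρ bdd) {a b : B}
    (hab : basicOpen ρ bdd a ⊆ basicOpen ρ bdd b) : a ≤ b := by
  by_contra hle
  obtain ⟨p, hp, hpa⟩ := exists_isPoint_mem h
    (fun h0 => hle (disjoint_compl_right_iff.1 (disjoint_iff.2 h0)) : a ⊓ bᶜ ≠ ⊥)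
  exact hp.disjoint_compl (hab (show (⟨p, hp⟩ : PointSpace ρ bdd) ∈ _ from
    hp.mem_of_le inf_le_left hpa)) (hp.mem_of_le inf_le_right hpa)

/-- If `aᶜ ∉ p`, no `b ∈ p` is disjoint from `a`, so some point contains `b ⊓ a`. -/
theorem mem_closure_basicOpen (h : IsLCA ρ bdd) {a : B} {p : PointSpace ρ bdd} :
    p ∈ closure (basicOpen ρ bdd a) ↔ aᶜ ∉ p.1 := by
  rw [mem_closure_iff_nhds]
  constructor
  · intro hp ha
    obtain ⟨q, hq, hqa⟩ := hp _ (mem_nhds_iff.2 ⟨_, ha, subset_rfl⟩)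
    exact q.2.disjoint_compl hqa hq
  · intro ha W hW
    obtain ⟨b, hb, hbW⟩ := mem_nhds_iff.1 hW
    obtain ⟨q, hq, hqb⟩ := exists_isPoint_mem h (a := b ⊓ a) fun h0 =>
      ha (p.2.mem_of_le (le_compl_iff_disjoint_right.2 (disjoint_iff.2 h0)) hb)
    exact ⟨⟨q, hq⟩, hbW (hq.mem_of_le inf_le_left hqb), hq.mem_of_le inf_le_right hqb⟩

theorem compl_closure_basicOpen (h : IsLCA ρ bdd) (a : B) :
    (closure (basicOpen ρ bdd a))ᶜ = basicOpen ρ bdd aᶜ :=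
  Set.ext fun p => by rw [Set.mem_compl_iff, mem_closure_basicOpen h, not_not, mem_basicOpen]

theorem interior_closure_basicOpen (h : IsLCA ρ bdd) (a : B) :
    interior (closure (basicOpen ρ bdd a)) = basicOpen ρ bdd a := by
  rw [interior_eq_compl_closure_compl, compl_closure_basicOpen h, compl_closure_basicOpen h,
    compl_compl]

theorem closure_basicOpen_subset (h : IsLCA ρ bdd) {a b : B} (hab : NTI ρ a b) :
    closure (basicOpen ρ bdd a) ⊆ basicOpen ρ bdd b :=
  fun p hp => (p.2.compl_mem_or hab).resolve_left ((mem_closure_basicOpen h).1 hp)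

theorem t2Space : T2Space (PointSpace ρ bdd) := by
  refine ⟨fun p q hpq => ?_⟩
  obtain ⟨a, hap, haq⟩ := Set.not_subset.1 fun h =>
    hpq (Subtype.ext (p.2.eq_of_subset q.2 h))
  obtain ⟨b, hb, -, hba⟩ := p.2.round hap
  refine ⟨_, _, isOpen_basicOpen b, isOpen_basicOpen bᶜ, hb,
    (q.2.compl_mem_or hba).resolve_right haq, ?_⟩
  exact Set.disjoint_left.2 fun r hr => r.2.disjoint_compl hr

/-- An ultrafilter on the space traces a deciding filter on `B`, and the round part of that filter
is a limit. -/
theorem isCompact_closure_basicOpen (h : IsLCA ρ bdd) {a : B} (ha : a ∈ bdd) :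
    IsCompact (closure (basicOpen ρ bdd a)) := by
  rw [isCompact_iff_ultrafilter_le_nhds]
  intro F hF
  rw [Filter.le_principal_iff] at hF
  have hu : IsDecidingFilter ρ bdd {b | basicOpen ρ bdd b ∈ F} := {
    bot_notMem := fun hb => by
      have h0 : basicOpen ρ bdd ⊥ = ∅ := Set.eq_empty_of_forall_notMem fun p => p.2.bot_notMem
      rw [Set.mem_ofPred_eq, h0] at hb
      exact F.empty_notMem hb
    mem_of_le := fun hab hA => Filter.mem_of_superset hA (basicOpen_mono hab)
    inf_mem := fun {b c} hb hc => by
      rw [Set.mem_ofPred_eq, basicOpen_inf]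
      exact Filter.inter_mem hb hc
    exists_bdd := by
      obtain ⟨b, hb, hab, -⟩ := h.bc1 a ⊤ ha (h.nti_top a)
      exact ⟨b, Filter.mem_of_superset hF (closure_basicOpen_subset h hab), hb⟩
    compl_mem_or := fun {b c} hbc => by
      rcases F.mem_or_compl_mem (closure (basicOpen ρ bdd b)) with h1 | h1
      · exact Or.inr (Filter.mem_of_superset h1 (closure_basicOpen_subset h hbc))
      · rw [compl_closure_basicOpen h] at h1
        exact Or.inl h1 }
  have hle : (F : Filter (PointSpace ρ bdd)) ≤ 𝓝 ⟨_, hu.isPoint h⟩ := by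
    intro W hW
    obtain ⟨b, hb, hbW⟩ := mem_nhds_iff.1 hW
    exact Filter.mem_of_superset (roundPart_subset h hu hb) hbW
  exact ⟨_, isClosed_iff_ultrafilter.1 isClosed_closure _ F hle hF, hle⟩

theorem locallyCompactSpace (h : IsLCA ρ bdd) : LocallyCompactSpace (PointSpace ρ bdd) := by
  refine ⟨fun p W hW => ?_⟩
  obtain ⟨a, ha, haW⟩ := mem_nhds_iff.1 hW
  obtain ⟨b, hb, hbb, hba⟩ := p.2.round ha
  exact ⟨_, mem_nhds_iff.2 ⟨b, hb, subset_closure⟩,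
    (closure_basicOpen_subset h hba).trans haW, isCompact_closure_basicOpen h hbb⟩

/-- Compactness selects one member of a family closed under joins. Taking the bounded elements, or
the elements `≪ b`, recovers boundedness and `≪` from the topology. -/
theorem exists_le_of_isCompact (h : IsLCA ρ bdd) {a : B} {S : Set B} (h0 : ⊥ ∈ S)
    (hsup : ∀ c ∈ S, ∀ d ∈ S, c ⊔ d ∈ S) (ha : IsCompact (closure (basicOpen ρ bdd a)))
    (hS : ∀ p ∈ closure (basicOpen ρ bdd a), ∃ c ∈ S, c ∈ p.1) : ∃ c ∈ S, a ≤ c := by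
  obtain ⟨c, hc, hac⟩ : ∃ c ∈ S, closure (basicOpen ρ bdd a) ⊆ basicOpen ρ bdd c := by
    refine ha.induction_on (p := fun s => ∃ c ∈ S, s ⊆ basicOpen ρ bdd c)
      ⟨⊥, h0, Set.empty_subset _⟩ ?_ ?_ ?_
    · rintro s t hst ⟨c, hc, htc⟩
      exact ⟨c, hc, hst.trans htc⟩
    · rintro s t ⟨c, hc, hsc⟩ ⟨d, hd, htd⟩
      exact ⟨c ⊔ d, hsup c hc d hd, Set.union_subset (hsc.trans (basicOpen_mono le_sup_left))
        (htd.trans (basicOpen_mono le_sup_right))⟩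
    · intro p hp
      obtain ⟨c, hc, hpc⟩ := hS p hp
      exact ⟨basicOpen ρ bdd c, mem_nhdsWithin_of_mem_nhds ((isOpen_basicOpen c).mem_nhds hpc),
        c, hc, subset_rfl⟩
  exact ⟨c, hc, le_of_basicOpen_subset h (subset_closure.trans hac)⟩

theorem isCompact_closure_basicOpen_iff (h : IsLCA ρ bdd) {a : B} :
    IsCompact (closure (basicOpen ρ bdd a)) ↔ a ∈ bdd := by
  refine ⟨fun ha => ?_, isCompact_closure_basicOpen h⟩
  obtain ⟨c, hc, hac⟩ := exists_le_of_isCompact h h.bb1 (fun c hc d hd => h.bb3 c d hc hd) ha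
    fun p _ => by
      obtain ⟨c, hc, hcb⟩ := p.2.exists_bdd
      exact ⟨c, hcb, hc⟩
  exact h.bb2 _ _ hac hc

theorem closure_basicOpen_subset_iff (h : IsLCA ρ bdd) {a b : B} :
    closure (basicOpen ρ bdd a) ⊆ basicOpen ρ bdd b ↔ NTI ρ a b := by
  refine ⟨fun hab => h.nti_of_bdd fun c hc => ?_, closure_basicOpen_subset h⟩
  obtain ⟨d, hd, had⟩ := exists_le_of_isCompact h (a := a ⊓ c) (S := {d | NTI ρ d b})
    (h.nti_bot b) (fun c hc d hd => h.nti_sup_left hc hd)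
    (isCompact_closure_basicOpen h (h.bb2 _ _ inf_le_right hc)) fun p hp => by
      obtain ⟨d, hd, -, hdb⟩ := p.2.round (hab (closure_mono (basicOpen_mono inf_le_left) hp))
      exact ⟨d, hdb, hd⟩
  exact h.nti_mono had le_rfl hd

theorem set_ofSet_basicOpen (h : IsLCA ρ bdd) (a : B) :
    (RegularOpens.ofSet (basicOpen ρ bdd a)).set = basicOpen ρ bdd a :=
  interior_closure_basicOpen h a

/-- `W` is a union of basic open sets, and the join of their indices, supplied by completeness, has
a basic open set with the same closure as `W`. -/
theorem exists_ofSet_basicOpen {B : Type*} [CompleteBooleanAlgebra B] {ρ : B → B → Prop}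
    {bdd : Set B} (h : IsLCA ρ bdd) (W : RegularOpens (PointSpace ρ bdd)) :
    ∃ a, RegularOpens.ofSet (basicOpen ρ bdd a) = W := by
  refine ⟨sSup {b | basicOpen ρ bdd b ⊆ W.set}, RegularOpens.set_injective ?_⟩
  refine Eq.trans (congrArg interior ?_) W.interior_closure_set
  apply subset_antisymm
  · intro p hp
    rw [mem_closure_basicOpen h] at hp
    by_contra hpW
    -- The basic open set of `c` misses `W`, so `c` is disjoint from each index `b`, hence from
    -- their join, although `p` lies in the closure.
    obtain ⟨c, hc, hcW⟩ := isOpen_iff.1 isClosed_closure.isOpen_compl p hpW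
    refine hp (p.2.mem_of_le ?_ hc)
    rw [le_compl_iff_disjoint_right, disjoint_sSup_iff]
    intro b hb
    rw [disjoint_iff]
    by_contra h0
    obtain ⟨q, hq, hqb⟩ := exists_isPoint_mem h h0
    exact hcW (show (⟨q, hq⟩ : PointSpace ρ bdd) ∈ _ from hq.mem_of_le inf_le_left hqb)
      (subset_closure (hb (hq.mem_of_le inf_le_right hqb)))
  · refine closure_mono fun p hp => ?_
    obtain ⟨b, hb, hbW⟩ := isOpen_iff.1 W.isOpen p hp
    exact p.2.mem_of_le (le_sSup hbW) hb

theorem bijective_ofSet_basicOpen {B : Type*} [CompleteBooleanAlgebra B] {ρ : B → B → Prop}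
    {bdd : Set B} (h : IsLCA ρ bdd) :
    Function.Bijective fun a => RegularOpens.ofSet (basicOpen ρ bdd a) := by
  refine ⟨fun a b hab => ?_, exists_ofSet_basicOpen h⟩
  have h1 : basicOpen ρ bdd a = basicOpen ρ bdd b :=
    (set_ofSet_basicOpen h a).symm.trans
      ((congrArg RegularOpens.set hab).trans (set_ofSet_basicOpen h b))
  exact le_antisymm (le_of_basicOpen_subset h h1.le) (le_of_basicOpen_subset h h1.ge)

/-- A complete local contact algebra is isomorphic to the regular open sets of its point space. -/
noncomputable def orderIso {B : Type*} [CompleteBooleanAlgebra B] {ρ : B → B → Prop}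
    {bdd : Set B} (h : IsLCA ρ bdd) : B ≃o RegularOpens (PointSpace ρ bdd) where
  toEquiv := Equiv.ofBijective _ (bijective_ofSet_basicOpen h)
  map_rel_iff' {a b} := by
    change (RegularOpens.ofSet (basicOpen ρ bdd a)).set ⊆
      (RegularOpens.ofSet (basicOpen ρ bdd b)).set ↔ a ≤ b
    rw [set_ofSet_basicOpen h, set_ofSet_basicOpen h]
    exact ⟨le_of_basicOpen_subset h, basicOpen_mono⟩

theorem set_orderIso {B : Type*} [CompleteBooleanAlgebra B] {ρ : B → B → Prop}
    {bdd : Set B} (h : IsLCA ρ bdd) (a : B) : (orderIso h a).set = basicOpen ρ bdd a :=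
  set_ofSet_basicOpen h a

end PointSpace

end Points

/-! ### Continuous maps and morphisms of regular open algebras -/

section Duality

open TopologicalSpace Topology

theorem OrderIso.isDLC {A B : Type*} [CompleteBooleanAlgebra A] [CompleteBooleanAlgebra B]
    {ρ : A → A → Prop} {bA : Set A} {η : B → B → Prop} {bB : Set B} (hB : IsLCA η bB)
    (e : A ≃o B) (hnti : ∀ a b, NTI η (e a) (e b) ↔ NTI ρ a b) (hbdd : ∀ a, e a ∈ bB ↔ a ∈ bA) :
    IsDLC ρ bA η bB e where
  dlc1 := e.map_bot
  dlc2 := e.map_inf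
  dlc3 a b _ hab := by rwa [map_compl', compl_compl, hnti]
  dlc4 b hb := ⟨e.symm b, by simpa [← hbdd] using hb, by simp⟩
  dlc5 a := by
    refine (hB.sSup_nti (e a)).trans (congrArg sSup (Set.ext fun x => ?_))
    constructor
    · rintro ⟨b, hb, hba, rfl⟩
      obtain ⟨c, rfl⟩ := e.surjective x
      exact ⟨c, (hbdd c).1 hb, (hnti c a).1 hba, rfl⟩
    · rintro ⟨c, hc, hca, rfl⟩
      exact ⟨e c, (hbdd c).2 hc, (hnti c a).2 hca, rfl⟩

/-- An order isomorphism preserving `≪` and boundedness is an isomorphism in **DHLC**. -/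
def DHLC.isoOfOrderIso {X Y : DHLC.{u}} (e : X.carrier ≃o Y.carrier)
    (hnti : ∀ a b, NTI Y.contact (e a) (e b) ↔ NTI X.contact a b)
    (hbdd : ∀ a, e a ∈ Y.bdd ↔ a ∈ X.bdd) : X ≅ Y where
  hom := ⟨e, e.isDLC Y.isLCA hnti hbdd⟩
  inv := ⟨e.symm, e.symm.isDLC X.isLCA (fun a b => by simp [← hnti])
    (fun a => by simp [← hbdd])⟩
  hom_inv_id := DHLC.Hom.ext <| funext fun a => by
    change dlcComp X.contact X.bdd e.symm e a = a
    simp only [dlcComp, e.symm_apply_apply]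
    exact (X.isLCA.sSup_nti a).symm
  inv_hom_id := DHLC.Hom.ext <| funext fun a => by
    change dlcComp Y.contact Y.bdd e e.symm a = a
    simp only [dlcComp, e.apply_symm_apply]
    exact (Y.isLCA.sSup_nti a).symm

namespace RegularOpens

variable {X Y Z : Type*} [TopologicalSpace X] [TopologicalSpace Y] [TopologicalSpace Z]

/-- The regularized preimage map. -/
def comap (f : X → Y) (V : RegularOpens Y) : RegularOpens X := ofSet (f ⁻¹' V.set)

theorem comap_id (V : RegularOpens X) : comap (fun x => x) V = V := V.ofSet_set

theorem preimage_subset_comap {f : X → Y} (hf : Continuous f) (V : RegularOpens Y) :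
    f ⁻¹' V.set ⊆ (comap f V).set :=
  subset_set_ofSet (V.isOpen.preimage hf)

theorem closure_comap_subset {f : X → Y} (hf : Continuous f) (V : RegularOpens Y) :
    closure (comap f V).set ⊆ f ⁻¹' closure V.set :=
  (closure_set_ofSet (V.isOpen.preimage hf)).trans_subset (hf.closure_preimage_subset _)

theorem le_sSup_ofSet {S : Set (RegularOpens X)} {W : Set X}
    (h : ∀ x ∈ W, ∃ U ∈ S, x ∈ U.set) : ofSet W ≤ sSup S := by
  rw [sSup_eq_ofSet]
  refine ofSet_mono fun x hx => ?_
  obtain ⟨U, hU, hxU⟩ := h x hx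
  exact Set.mem_biUnion hU hxU

/-- Regularizing twice may enlarge a preimage, so plain composition is wrong; restricting to `V ≪ W`
absorbs the excess. -/
theorem comap_comp [T2Space Z] [LocallyCompactSpace Z] {f : X → Y} {g : Y → Z}
    (hf : Continuous f) (hg : Continuous g) :
    comap (g ∘ f) = dlcComp (Contact (X := Z)) (bounded Z) (comap f) (comap g) := by
  funext W
  apply le_antisymm
  · refine le_sSup_ofSet fun x hx => ?_
    obtain ⟨V, hV, hxV, hVW⟩ := exists_mem_between W.isOpen hx
    exact ⟨_, ⟨V, hV, nti_contact.2 hVW, rfl⟩,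
      preimage_subset_comap hf _ (preimage_subset_comap hg V hxV)⟩
  · refine sSup_le ?_
    rintro _ ⟨V, -, hVW, rfl⟩
    refine ofSet_mono (Set.preimage_mono (f := f) (t := g ⁻¹' W.set) ?_)
    exact subset_closure.trans ((closure_comap_subset hg V).trans
      (Set.preimage_mono (nti_contact.1 hVW)))

variable [T2Space Y] [LocallyCompactSpace Y]

theorem isDLC_comap {f : X → Y} (hf : Continuous f) :
    IsDLC (Contact (X := Y)) (bounded Y) (Contact (X := X)) (bounded X) (comap f) where
  dlc1 := by rw [comap, set_bot, Set.preimage_empty, ← set_bot, ofSet_set]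
  dlc2 U V := ofSet_inter (U.isOpen.preimage hf) (V.isOpen.preimage hf)
  dlc3 U V _ hUV := by
    rw [nti_contact] at hUV ⊢
    have h1 : closure (comap f Uᶜ)ᶜ.set ⊆ f ⁻¹' closure U.set := by
      refine closure_minimal ?_ (isClosed_closure.preimage hf)
      rw [set_compl, Set.compl_subset_comm, ← Set.preimage_compl, ← set_compl]
      exact (preimage_subset_comap hf _).trans subset_closure
    exact h1.trans ((Set.preimage_mono hUV).trans (preimage_subset_comap hf V))
  dlc4 U hU := by
    obtain ⟨V, hV, hUV, -⟩ := exists_between (hU.image hf) isOpen_univ (Set.subset_univ _)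
    refine ⟨V, hV, set_subset_set.1 ?_⟩
    exact subset_closure.trans ((Set.image_subset_iff.1 hUV).trans (preimage_subset_comap hf V))
  dlc5 V := by
    apply le_antisymm
    · refine le_sSup_ofSet fun x hx => ?_
      obtain ⟨U, hU, hxU, hUV⟩ := exists_mem_between V.isOpen hx
      exact ⟨_, ⟨U, hU, nti_contact.2 hUV, rfl⟩, preimage_subset_comap hf U hxU⟩
    · refine sSup_le ?_
      rintro _ ⟨U, -, hUV, rfl⟩
      exact ofSet_mono (Set.preimage_mono (subset_closure.trans (nti_contact.1 hUV)))

theorem comap_injective {f g : X → Y} (hf : Continuous f) (hg : Continuous g)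
    (h : comap f = comap g) : f = g := by
  funext x
  by_contra hne
  obtain ⟨V, W, hV, hW, hxV, hxW, hVW⟩ := t2_separation hne
  obtain ⟨U, -, hxU, hUV⟩ := exists_mem_between hV hxV
  have h1 : x ∈ closure (comap g U).set := by
    rw [← h]
    exact subset_closure (preimage_subset_comap hf U hxU)
  exact Set.disjoint_left.1 hVW (hUV (closure_comap_subset hg U h1)) hxW

/-- Meeting all members with one bounded member gives a directed family with compact closures, which
share a point `y`. Roundness puts `y` in every member, and the deciding property puts every regular
open neighbourhood of `y` in `p`. -/
theorem exists_of_isPoint {p : Set (RegularOpens Y)}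
    (hp : IsPoint (Contact (X := Y)) (bounded Y) p) : ∃ y : Y, p = {U | y ∈ U.set} := by
  obtain ⟨y, hy⟩ : (⋂ U : p, closure U.1.set).Nonempty := by
    obtain ⟨K, hK, hKb⟩ := hp.exists_bdd
    have : Nonempty p := ⟨⟨K, hK⟩⟩
    have h1 : (⋂ U : p, closure (K ⊓ U.1).set).Nonempty := by
      refine IsCompact.nonempty_iInter_of_directed_nonempty_isCompact_isClosed _ ?_ ?_ ?_
        fun _ => isClosed_closure
      · exact fun U V => ⟨⟨U.1 ⊓ V.1, hp.inf_mem U.2 V.2⟩,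
          closure_mono (set_subset_set.2 (inf_le_inf_left K inf_le_left)),
          closure_mono (set_subset_set.2 (inf_le_inf_left K inf_le_right))⟩
      · intro U
        rw [closure_nonempty_iff, Set.nonempty_iff_ne_empty]
        exact fun h => hp.bot_notMem (set_injective (a₁ := K ⊓ U.1) (a₂ := ⊥) h ▸
          hp.inf_mem hK U.2)
      · exact fun U => IsCompact.of_isClosed_subset hKb isClosed_closure
          (closure_mono (set_subset_set.2 inf_le_left))
    exact h1.mono (Set.iInter_mono fun U => closure_mono (set_subset_set.2 inf_le_right))
  rw [Set.mem_iInter] at hy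
  refine ⟨y, Set.ext fun U => ⟨fun hU => ?_, fun hU => ?_⟩⟩
  · obtain ⟨V, hV, -, hVU⟩ := hp.round hU
    exact nti_contact.1 hVU (hy ⟨V, hV⟩)
  · obtain ⟨V, -, hyV, hVU⟩ := exists_mem_between U.isOpen hU
    refine (hp.compl_mem_or (nti_contact.2 hVU)).resolve_left fun h => ?_
    have h1 := hy ⟨Vᶜ, h⟩
    rw [set_compl, closure_compl, V.interior_closure_set] at h1
    exact h1 hyV

/-- The value `f x` is the point given by the round part of `{U | x ∈ ψ U}`. Hence the preimage of
`V` is the union of all `ψ U` with `U` bounded and `U ≪ V`; this gives continuity, and (DLC5) gives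
`comap f = ψ`. -/
theorem exists_comap_eq [T2Space X] [LocallyCompactSpace X]
    {ψ : RegularOpens Y → RegularOpens X}
    (h : IsDLC (Contact (X := Y)) (bounded Y) (Contact (X := X)) (bounded X) ψ) :
    ∃ f : X → Y, Continuous f ∧ comap f = ψ := by
  have hu : ∀ x : X, IsDecidingFilter (Contact (X := Y)) (bounded Y) {U | x ∈ (ψ U).set} :=
    fun x => {
      bot_notMem := by
        rw [Set.mem_ofPred_eq, h.dlc1]
        exact Set.notMem_empty x
      mem_of_le := fun hUV hU => h.mono hUV hU
      inf_mem := fun {U V} hU hV => by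
        rw [Set.mem_ofPred_eq, h.dlc2]
        exact ⟨hU, hV⟩
      exists_bdd := by
        obtain ⟨K, hK, hxK, -⟩ := exists_mem_between isOpen_univ (Set.mem_univ x)
        obtain ⟨U, hU, hKU⟩ := h.dlc4 K hK
        exact ⟨U, hKU hxK, hU⟩
      compl_mem_or := fun {U V} hUV => by
        have h1 := nti_contact.1 (h.dlc3' (isLCA Y) (isLCA X) hUV)
        by_contra! hcon
        refine hcon.2 (h1 ?_)
        -- Since `ψ Uᶜ` is regular, a point outside it lies in the closure of `(ψ Uᶜ)ᶜ`, where `h1`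
        -- applies.
        have h2 := hcon.1
        rw [Set.mem_ofPred_eq, ← interior_closure_set, ← Set.mem_compl_iff, ← closure_compl,
          ← set_compl] at h2
        exact h2 }
  choose f hf using fun x => exists_of_isPoint ((hu x).isPoint (isLCA Y))
  have hpre : ∀ V : RegularOpens Y,
      f ⁻¹' V.set = ⋃ W ∈ {W | ∃ U ∈ bounded Y, NTI Contact U V ∧ W = ψ U}, W.set := by
    intro V
    ext x
    have h1 := Set.ext_iff.1 (hf x) V
    rw [Set.mem_preimage, ← Set.mem_ofPred_eq (p := fun U : RegularOpens Y => f x ∈ U.set), ← h1]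
    simp only [roundPart, Set.mem_ofPred_eq, Set.mem_iUnion, exists_prop]
    constructor
    · rintro ⟨U, hxU, hU, hUV⟩
      exact ⟨_, ⟨U, hU, hUV, rfl⟩, hxU⟩
    · rintro ⟨_, ⟨U, hU, hUV, rfl⟩, hxU⟩
      exact ⟨U, hxU, hU, hUV⟩
  refine ⟨f, ?_, ?_⟩
  · refine continuous_def.2 fun W hW => isOpen_iff_mem_nhds.2 fun x hx => ?_
    obtain ⟨V, -, hxV, hVW⟩ := exists_mem_between hW hx
    have hop : IsOpen (f ⁻¹' V.set) := by
      rw [hpre]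
      exact isOpen_biUnion fun W _ => W.isOpen
    exact Filter.mem_of_superset (hop.mem_nhds hxV)
      (Set.preimage_mono (subset_closure.trans hVW))
  · funext V
    rw [comap, hpre, ← sSup_eq_ofSet, ← h.dlc5]

end RegularOpens

end Duality

/-! ### The equivalence with locally compact Hausdorff spaces -/

instance HLC.t2Space (X : HLC.{u}) : T2Space X.obj := X.property.1

instance HLC.locallyCompactSpace (X : HLC.{u}) : LocallyCompactSpace X.obj := X.property.2

/-- The contravariant functor of regular open sets. -/
noncomputable def HLC.toDHLC : HLC.{u}ᵒᵖ ⥤ DHLC.{u} where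
  obj X :=
    ⟨RegularOpens X.unop.obj, RegularOpens.Contact, RegularOpens.bounded _, RegularOpens.isLCA _⟩
  map f := ⟨RegularOpens.comap f.unop.hom, RegularOpens.isDLC_comap f.unop.hom.hom.continuous⟩
  map_id _ := DHLC.Hom.ext (funext RegularOpens.comap_id)
  map_comp {X Y Z} f g := DHLC.Hom.ext <|
    RegularOpens.comap_comp (X := Z.unop.obj) (Y := Y.unop.obj) (Z := X.unop.obj)
      (f := g.unop.hom) (g := f.unop.hom) g.unop.hom.hom.continuous f.unop.hom.hom.continuous

instance : HLC.toDHLC.{u}.Faithful where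
  map_injective {X Y} f g h := by
    apply Quiver.Hom.unop_inj
    ext x
    exact congrFun (RegularOpens.comap_injective f.unop.hom.hom.continuous
      g.unop.hom.hom.continuous (congrArg DHLC.Hom.toFun h)) x

instance : HLC.toDHLC.{u}.Full where
  map_surjective {X Y} ψ := by
    obtain ⟨f, hf, h⟩ := RegularOpens.exists_comap_eq (DHLC.Hom.isDLC ψ)
    exact ⟨Quiver.Hom.op (ObjectProperty.homMk (TopCat.ofHom ⟨f, hf⟩)), DHLC.Hom.ext h⟩

instance : HLC.toDHLC.{u}.EssSurj where
  mem_essImage B := by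
    refine ⟨Opposite.op ⟨TopCat.of (PointSpace B.contact B.bdd), PointSpace.t2Space,
      PointSpace.locallyCompactSpace B.isLCA⟩, ⟨(DHLC.isoOfOrderIso
        (PointSpace.orderIso B.isLCA) (fun a b => ?_) fun a => ?_).symm⟩⟩
    · refine RegularOpens.nti_contact.trans ?_
      change closure (PointSpace.orderIso B.isLCA a).set ⊆
        (PointSpace.orderIso B.isLCA b).set ↔ NTI B.contact a b
      rw [PointSpace.set_orderIso, PointSpace.set_orderIso]
      exact PointSpace.closure_basicOpen_subset_iff B.isLCA
    · change IsCompact (closure (PointSpace.orderIso B.isLCA a).set) ↔ _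
      rw [PointSpace.set_orderIso]
      exact PointSpace.isCompact_closure_basicOpen_iff B.isLCA

instance : HLC.toDHLC.{u}.IsEquivalence where

/-- The isomorphism of **DHLC** and **MVDHLC**, as an equivalence of categories. -/
def DHLC.equivMVDHLC : DHLC.{u} ≌ MVDHLC.{u} :=
  CategoryTheory.Equivalence.mk DHLC.toMVDHLC MVDHLC.toDHLC (eqToIso DHLC.toMVDHLC_comp_toDHLC.symm)
    (eqToIso MVDHLC.toDHLC_comp_toMVDHLC)

theorem theorem2 :
    (∃ (P : DHLC.{u} ⥤ MVDHLC.{u}) (Q : MVDHLC.{u} ⥤ DHLC.{u}),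
      P ⋙ Q = 𝟭 DHLC.{u} ∧ Q ⋙ P = 𝟭 MVDHLC.{u}) ∧
    Nonempty (MVDHLC.{u}ᵒᵖ ≌ HLC.{u}) :=
  ⟨⟨DHLC.toMVDHLC, MVDHLC.toDHLC, DHLC.toMVDHLC_comp_toDHLC, MVDHLC.toDHLC_comp_toMVDHLC⟩,
    ⟨(HLC.toDHLC.asEquivalence.trans DHLC.equivMVDHLC).rightOp.symm⟩⟩
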